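/- Let $d\ge 1$ be an integer and let $\Delta\ge 0$ be a real number, both fixed. For $n\ge 0$ let $$p_d(n,\Delta)=\sup_{V,B}\,\mathbf P(X_V\in B),\qquad X_V=\xi_1v_1+\dots+\xi_nv_n,$$ where $\xi_1,\dots,\xi_n$ are independent random signs, each equal to $1$ or $-1$ with probability $1/2$, and the supremum is taken over all multisets $V=\{v_1,\dots,v_n\}$ of $n$ vectors in $\mathbf R^d$ of Euclidean length at least $1$ and all closed balls $B\subset\mathbf R^d$ of radius $\Delta$. Let $s=\lfloor\Delta\rfloor+1$, and let $S(n,s)$ be the sum of the $s$ largest binomial coefficients $\binom ni$, $0\le i\le n$ (of all of them if $s>n+1$). Then $$p_d(n,\Delta)=(1+o(1))\,2^{-n}S(n,s)\qquad\text{as } n\to\infty .$$ -/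

import Mathlib

open Filter Asymptotics MeasureTheory
open scoped ENNReal

namespace LittlewoodOfford

/-- The law of a single random sign: `1` and `-1` with probability `1/2` each. -/
noncomputable def signLaw : Measure ℝ :=
  (2⁻¹ : ℝ≥0∞) • (Measure.dirac 1 + Measure.dirac (-1))

/-- The joint law of `n` independent random signs `ξ₁, …, ξₙ`. -/
noncomputable def signsLaw (n : ℕ) : Measure (Fin n → ℝ) :=
  Measure.pi fun _ => signLaw

/-- The random sum `X_V = ξ₁ v₁ + ⋯ + ξₙ vₙ`, as a function of the signs. -/
noncomputable def randomSum {d n : ℕ} (v : Fin n → EuclideanSpace ℝ (Fin d)) (ξ : Fin n → ℝ) :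
    EuclideanSpace ℝ (Fin d) :=
  ∑ i, ξ i • v i

/-- The probability that `X_V` lies in the closed ball of centre `c` and radius `Δ`. -/
noncomputable def ballProb {d n : ℕ} (v : Fin n → EuclideanSpace ℝ (Fin d))
    (c : EuclideanSpace ℝ (Fin d)) (Δ : ℝ) : ℝ :=
  (signsLaw n).real {ξ | randomSum v ξ ∈ Metric.closedBall c Δ}

/-- The small ball probability `p_d(n, Δ)`: the supremum of `P(X_V ∈ B)` over all families `V` of
`n` vectors of length at least one in `ℝ^d` and all closed balls `B` of radius `Δ`. For `1 ≤ d`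
this is the supremum of a nonempty set of reals contained in `[0, 1]`. -/
noncomputable def smallBallProb (d n : ℕ) (Δ : ℝ) : ℝ :=
  sSup {p : ℝ | ∃ (v : Fin n → EuclideanSpace ℝ (Fin d)) (c : EuclideanSpace ℝ (Fin d)),
    (∀ i, 1 ≤ ‖v i‖) ∧ p = ballProb v c Δ}

/-- The sum `S(n, m)` of the `m` largest binomial coefficients `n.choose i`, `0 ≤ i ≤ n`
(of all of them when `m > n`): the largest sum over at most `m` distinct indices. -/
def largestBinomSum (n m : ℕ) : ℕ :=
  ((Finset.range (n + 1)).powerset.filter fun T => T.card ≤ m).sup fun T =>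
    ∑ i ∈ T, n.choose i

end LittlewoodOfford

/-!
Write `b n = centralProb n` for the largest point mass of the symmetric binomial law and
`s = ⌊Δ⌋ + 1`. Both sides are asymptotic to `s * b n`. For `2⁻ⁿ S(n, s)` this holds because binomial
coefficients at a fixed distance from the middle are asymptotic to the middle one, and taking all
vectors equal gives the same lower bound for `p_d(n, Δ)` (`middleMass_le_smallBallProb`).

For the upper bound fix a small `ε > 0` and compare with the lines through the vectors of the family
(`exists_smallBallProb_le_max`), with `q = ⌈n ^ (3/4)⌉`.

* If fewer than `4 * q` vectors are at distance at least `ε` from one of these lines, project to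
  that line. The remaining vectors have components at least `r = √(1 - ε²)`, and `ε` is chosen such
  that `Δ < s * r`. An interval of length `2 * Δ` is then covered by `s` half-open intervals of
  length `2 * r`, and Sperner's theorem bounds the mass of each by `b (n - 4 * q)`
  (`ballProb_le_of_line`). As `q = o(n)`, this is `(1 + o(1)) * s * b n`.

* Otherwise one can choose greedily `2 * q` disjoint pairs `(v, w)` with `w` far from the line
  through `v` (`exists_disjoint_pairs`). Majorize the indicator of the ball by a Gaussian and pass to
  Fourier space: the probability is at most a constant times `E ∏ᵢ |cos ⟪g, vᵢ⟫|` with `g` a standard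
  Gaussian vector. Hölder's inequality over the pairs leaves `E (cos ⟪g, v⟫ cos ⟪g, w⟫) ^ (2 * q)` for
  a single pair. Transformed back, this is a Gaussian average over a random point of the lattice
  generated by `v` and `w` with independent binomial coordinates, hence at most
  `b (2 * q) ^ 2` times a Gaussian sum over the lattice, which is bounded in terms of `ε`
  (`exists_ballProb_le_of_far`). Since `b n` has order `n ^ (-1/2)`, the bound `O(1 / q)` so obtained
  is `o(b n)`.
-/

namespace LittlewoodOfford

/-! ### Central binomial probabilities -/

/-- The largest point mass `2⁻ⁿ (n choose ⌊n/2⌋)` of the symmetric binomial law. -/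
noncomputable def centralProb (n : ℕ) : ℝ := (n.choose (n / 2) : ℝ) / 2 ^ n

lemma centralProb_pos (n : ℕ) : 0 < centralProb n := by
  have : 0 < n.choose (n / 2) := Nat.choose_pos (Nat.div_le_self n 2)
  unfold centralProb
  positivity

lemma choose_div_le_centralProb (n k : ℕ) : (n.choose k : ℝ) / 2 ^ n ≤ centralProb n := by
  unfold centralProb
  gcongr
  exact Nat.choose_le_middle k n

lemma centralProb_succ_le (n : ℕ) : centralProb (n + 1) ≤ centralProb n := by
  have h : (n + 1).choose ((n + 1) / 2) ≤ 2 * n.choose (n / 2) := by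
    rcases Nat.eq_zero_or_pos ((n + 1) / 2) with h0 | h0
    · rw [h0, Nat.choose_zero_right]
      have : 0 < n.choose (n / 2) := Nat.choose_pos (Nat.div_le_self n 2)
      omega
    · obtain ⟨k, hk⟩ : ∃ k, (n + 1) / 2 = k + 1 := ⟨(n + 1) / 2 - 1, by omega⟩
      rw [hk, Nat.choose_succ_succ]
      have h1 := Nat.choose_le_middle k n
      have h2 := Nat.choose_le_middle (k + 1) n
      simp only [Nat.succ_eq_add_one]
      omega
  have h' : ((n + 1).choose ((n + 1) / 2) : ℝ) ≤ 2 * n.choose (n / 2) := by exact_mod_cast h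
  unfold centralProb
  rw [div_le_div_iff₀ (by positivity) (by positivity), pow_succ]
  calc _ ≤ 2 * (n.choose (n / 2) : ℝ) * 2 ^ n := by gcongr
    _ = _ := by ring

lemma centralProb_antitone : Antitone centralProb := antitone_nat_of_succ_le centralProb_succ_le

/-- The sequence `(n + 1) * centralProb n` increases; together with `centralProb_antitone` this
controls the ratio of `centralProb` at nearby arguments. -/
lemma monotone_succ_mul_centralProb : Monotone fun n : ℕ => ((n : ℝ) + 1) * centralProb n := by
  refine monotone_nat_of_le_succ fun n => ?_
  have h : 2 * (n + 1) * n.choose (n / 2) ≤ (n + 2) * (n + 1).choose ((n + 1) / 2) := by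
    have h1 := Nat.choose_le_middle (n / 2 + 1) (n + 1)
    have h2 := Nat.add_one_mul_choose_eq n (n / 2)
    calc 2 * (n + 1) * n.choose (n / 2) = (2 * (n / 2 + 1)) * (n + 1).choose (n / 2 + 1) := by
          rw [mul_assoc, h2]; ring
      _ ≤ _ := Nat.mul_le_mul (by omega) h1
  have h' : 2 * ((n : ℝ) + 1) * n.choose (n / 2) ≤ (n + 2) * (n + 1).choose ((n + 1) / 2) := by
    exact_mod_cast h
  unfold centralProb
  rw [mul_div_assoc', mul_div_assoc', div_le_div_iff₀ (by positivity) (by positivity), pow_succ]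
  push_cast
  nlinarith [pow_pos (two_pos : (0 : ℝ) < 2) n]

lemma centralProb_two_mul (m : ℕ) : centralProb (2 * m) = (m.centralBinom : ℝ) / 4 ^ m := by
  rw [centralProb, Nat.centralBinom, Nat.mul_div_cancel_left m two_pos, pow_mul]
  norm_num

lemma centralProb_two_mul_succ (m : ℕ) :
    centralProb (2 * (m + 1)) * (2 * (m + 1)) = centralProb (2 * m) * (2 * m + 1) := by
  have h : ((m : ℝ) + 1) * (m + 1).centralBinom = 2 * (2 * m + 1) * m.centralBinom := by
    exact_mod_cast Nat.succ_mul_centralBinom_succ m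
  rw [centralProb_two_mul, centralProb_two_mul, pow_succ]
  field_simp
  linarith

lemma centralProb_two_mul_sq_le (m : ℕ) : (2 * m + 1) * centralProb (2 * m) ^ 2 ≤ 1 := by
  induction m with
  | zero => simp [centralProb]
  | succ m ih =>
    have h := centralProb_two_mul_succ m
    have e : centralProb (2 * (m + 1)) = centralProb (2 * m) * (2 * m + 1) / (2 * (m + 1)) := by
      field_simp; linarith
    rw [e]
    push_cast
    calc (2 * ((m : ℝ) + 1) + 1) * (centralProb (2 * m) * (2 * m + 1) / (2 * (m + 1))) ^ 2
        = ((2 * m + 1) * centralProb (2 * m) ^ 2) *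
            ((2 * m + 3) * (2 * m + 1) / (2 * (m + 1)) ^ 2) := by rw [div_pow]; ring
      _ ≤ 1 * 1 := by
          gcongr
          rw [div_le_one (by positivity)]
          nlinarith
      _ = 1 := one_mul 1

lemma one_le_mul_centralProb_two_mul_sq (m : ℕ) (hm : 1 ≤ m) :
    1 ≤ 4 * m * centralProb (2 * m) ^ 2 := by
  induction m, hm using Nat.le_induction with
  | base => norm_num [centralProb]
  | succ m hm ih =>
    have h := centralProb_two_mul_succ m
    have e : centralProb (2 * (m + 1)) = centralProb (2 * m) * (2 * m + 1) / (2 * (m + 1)) := by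
      field_simp; linarith
    have hm0 : (0 : ℝ) < m := by exact_mod_cast hm
    rw [e]
    push_cast
    calc (1 : ℝ) = 1 * 1 := (one_mul 1).symm
      _ ≤ (4 * m * centralProb (2 * m) ^ 2) * ((2 * m + 1) ^ 2 / (4 * m * (m + 1))) := by
          gcongr
          rw [one_le_div (by positivity)]
          nlinarith
      _ = _ := by field_simp; ring

lemma one_div_le_centralProb_sq (n : ℕ) (hn : 1 ≤ n) : 1 / (4 * n) ≤ centralProb n ^ 2 := by
  have h0 : (0 : ℝ) < n := by exact_mod_cast hn
  rw [div_le_iff₀' (by positivity)]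
  refine (one_le_mul_centralProb_two_mul_sq n hn).trans ?_
  have := (centralProb_pos (2 * n)).le
  gcongr
  exact centralProb_antitone (by omega)

/-- A binomial coefficient at a fixed offset from the middle is asymptotic to the middle one. -/
lemma tendsto_choose_middle_add (j : ℕ) :
    Tendsto (fun n : ℕ => ((n.choose (n / 2 + j) : ℝ) / 2 ^ n) / centralProb n) atTop (nhds 1) := by
  induction j with
  | zero =>
    refine tendsto_const_nhds.congr fun n => ?_
    exact (div_self (centralProb_pos n).ne').symm
  | succ j ih =>
    have hr : Tendsto (fun n : ℕ => ((n - (n / 2 + j) : ℕ) : ℝ) / ((n / 2 + j + 1 : ℕ) : ℝ)) atTop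
        (nhds 1) := by
      rw [tendsto_iff_norm_sub_tendsto_zero]
      have hz : Tendsto (fun n : ℕ => (4 * (j : ℝ) + 4) / n) atTop (nhds 0) :=
        tendsto_const_div_atTop_nhds_zero_nat _
      refine squeeze_zero' (Eventually.of_forall fun n => norm_nonneg _) ?_ hz
      filter_upwards [eventually_ge_atTop (2 * j + 2)] with n hn
      have hp : (0 : ℝ) < ((n / 2 + j + 1 : ℕ) : ℝ) := by positivity
      have hn0 : (0 : ℝ) < n := by
        have : 0 < n := by omega
        exact_mod_cast this
      rw [div_sub_one hp.ne', norm_div, Real.norm_eq_abs, Real.norm_eq_abs, abs_of_pos hp]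
      have h1 : |((n - (n / 2 + j) : ℕ) : ℝ) - ((n / 2 + j + 1 : ℕ) : ℝ)| ≤ 2 * j + 2 := by
        obtain ⟨a, b, ha, hb, hab⟩ : ∃ a b : ℕ, a = n - (n / 2 + j) ∧ b = n / 2 + j + 1 ∧
            (a ≤ b ∧ b ≤ a + (2 * j + 2)) := ⟨_, _, rfl, rfl, by omega⟩
        rw [← ha, ← hb]
        have e1 : (a : ℝ) ≤ b := by exact_mod_cast hab.1
        have e2 : (b : ℝ) ≤ a + (2 * j + 2) := by exact_mod_cast hab.2
        rw [abs_le]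
        constructor <;> linarith
      have h2 : (n : ℝ) ≤ 2 * ((n / 2 + j + 1 : ℕ) : ℝ) := by
        have : n ≤ 2 * (n / 2 + j + 1) := by omega
        exact_mod_cast this
      rw [div_le_div_iff₀ hp hn0]
      calc _ ≤ (2 * (j : ℝ) + 2) * (2 * ((n / 2 + j + 1 : ℕ) : ℝ)) := by gcongr
        _ = _ := by ring
    have := ih.mul hr
    rw [one_mul] at this
    refine this.congr fun n => ?_
    have h := Nat.choose_succ_right_eq n (n / 2 + j)
    have h' : (n.choose (n / 2 + (j + 1)) : ℝ) * ((n / 2 + j + 1 : ℕ) : ℝ) =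
        n.choose (n / 2 + j) * ((n - (n / 2 + j) : ℕ) : ℝ) := by exact_mod_cast h
    have hp : ((n / 2 + j + 1 : ℕ) : ℝ) ≠ 0 := by positivity
    rw [eq_div_of_mul_eq hp h']
    ring

/-- The binomial mass of the `s` consecutive points starting at the middle. -/
noncomputable def middleMass (n s : ℕ) : ℝ :=
  ∑ j ∈ Finset.range s, (n.choose (n / 2 + j) : ℝ) / 2 ^ n

lemma tendsto_middleMass_div (s : ℕ) :
    Tendsto (fun n => middleMass n s / centralProb n) atTop (nhds s) := by
  have := tendsto_finsetSum (Finset.range s) fun j _ => tendsto_choose_middle_add j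
  simp only [Finset.sum_const, Finset.card_range, nsmul_eq_mul, mul_one] at this
  refine this.congr fun n => ?_
  rw [middleMass, Finset.sum_div]

lemma largestBinomSum_le (n s : ℕ) :
    ((2 : ℝ) ^ n)⁻¹ * largestBinomSum n s ≤ s * centralProb n := by
  have h : largestBinomSum n s ≤ s * n.choose (n / 2) := by
    refine Finset.sup_le fun T hT => ?_
    have hT' := (Finset.mem_filter.1 hT).2
    calc ∑ i ∈ T, n.choose i ≤ ∑ _i ∈ T, n.choose (n / 2) :=
          Finset.sum_le_sum fun i _ => Nat.choose_le_middle i n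
      _ = T.card * n.choose (n / 2) := by simp
      _ ≤ _ := Nat.mul_le_mul_right _ hT'
  have h' : (largestBinomSum n s : ℝ) ≤ s * n.choose (n / 2) := by exact_mod_cast h
  rw [centralProb, mul_div_assoc', inv_mul_eq_div]
  gcongr

lemma middleMass_le_largestBinomSum (n s : ℕ) (hs : n / 2 + s ≤ n + 1) :
    middleMass n s ≤ ((2 : ℝ) ^ n)⁻¹ * largestBinomSum n s := by
  have h : ∑ j ∈ Finset.range s, n.choose (n / 2 + j) ≤ largestBinomSum n s := by
    have e : ∑ j ∈ Finset.range s, n.choose (n / 2 + j) =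
        ∑ i ∈ (Finset.range s).image (n / 2 + ·), n.choose i := by
      rw [Finset.sum_image fun a _ b _ hab => Nat.add_left_cancel hab]
    rw [e]
    refine Finset.le_sup (f := fun T => ∑ i ∈ T, n.choose i) ?_
    rw [Finset.mem_filter, Finset.mem_powerset]
    refine ⟨fun i hi => ?_, Finset.card_image_le.trans (by simp)⟩
    obtain ⟨j, hj, rfl⟩ := Finset.mem_image.1 hi
    rw [Finset.mem_range] at hj ⊢
    omega
  rw [middleMass, ← Finset.sum_div, inv_mul_eq_div]
  gcongr
  exact_mod_cast h

/-! ### Sign patterns -/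

open Classical in
/-- The sign vector that is `1` on `A` and `-1` off `A`. Finite sets `A` thus encode the values of
the random signs, and inclusion of sets is the order that Sperner's theorem refers to. -/
noncomputable def sign {ι : Type*} (A : Finset ι) (i : ι) : ℝ := if i ∈ A then 1 else -1

lemma sign_of_mem {ι : Type*} {A : Finset ι} {i : ι} (h : i ∈ A) : sign A i = 1 := by simp [sign, h]

lemma sign_of_notMem {ι : Type*} {A : Finset ι} {i : ι} (h : i ∉ A) : sign A i = -1 := by
  simp [sign, h]

lemma signsLaw_eq_sum_dirac (n : ℕ) :
    signsLaw n = (2⁻¹ : ℝ≥0∞) ^ n • ∑ A : Finset (Fin n), Measure.dirac (sign A) := by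
  have : IsFiniteMeasure signLaw := by
    refine ⟨?_⟩
    simp [signLaw]
  refine Measure.pi_eq fun s hs => ?_
  have h1 : ∀ i, signLaw (s i) = 2⁻¹ * ((s i).indicator 1 1 + (s i).indicator 1 (-1)) := by
    intro i
    simp [signLaw, Measure.dirac_apply' _ (hs i), mul_add]
  have h2 : ∀ A : Finset (Fin n), Measure.dirac (sign A) (Set.pi Set.univ s) =
      (∏ i ∈ A, (s i).indicator (1 : ℝ → ℝ≥0∞) 1) *
        ∏ i ∈ Aᶜ, (s i).indicator (1 : ℝ → ℝ≥0∞) (-1) := by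
    intro A
    have e1 : Measure.dirac (sign A) (Set.pi Set.univ s) =
        ∏ i, (s i).indicator (1 : ℝ → ℝ≥0∞) (sign A i) := by
      rw [Measure.dirac_apply' _ (MeasurableSet.univ_pi hs)]
      by_cases h : sign A ∈ Set.pi Set.univ s
      · rw [Set.indicator_of_mem h]
        refine (Finset.prod_eq_one fun i _ => ?_).symm
        rw [Set.indicator_of_mem (h i (Set.mem_univ i))]
        rfl
      · rw [Set.indicator_of_notMem h]
        obtain ⟨i, hi⟩ : ∃ i, sign A i ∉ s i := by simpa [Set.mem_pi] using h
        exact (Finset.prod_eq_zero (Finset.mem_univ i) (Set.indicator_of_notMem hi _)).symm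
    rw [e1, ← Finset.prod_mul_prod_compl A]
    congr 1
    · exact Finset.prod_congr rfl fun i hi => by rw [sign_of_mem hi]
    · exact Finset.prod_congr rfl fun i hi => by rw [sign_of_notMem (Finset.mem_compl.1 hi)]
  simp only [h1, Finset.prod_mul_distrib, Fintype.prod_add, Measure.smul_apply,
    Measure.finsetSum_apply, h2, smul_eq_mul]
  simp

open Classical in
lemma ballProb_eq_card_div {d n : ℕ} (v : Fin n → EuclideanSpace ℝ (Fin d))
    (c : EuclideanSpace ℝ (Fin d)) (Δ : ℝ) :
    ballProb v c Δ =
      ((Finset.univ.filter fun A : Finset (Fin n) =>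
        ‖∑ i, sign A i • v i - c‖ ≤ Δ).card : ℝ) / 2 ^ n := by
  have hm : MeasurableSet {ξ : Fin n → ℝ | randomSum v ξ ∈ Metric.closedBall c Δ} := by
    refine IsClosed.measurableSet (Metric.isClosed_closedBall.preimage ?_)
    unfold randomSum
    fun_prop
  have h : ∀ A : Finset (Fin n),
      Measure.dirac (sign A) {ξ : Fin n → ℝ | randomSum v ξ ∈ Metric.closedBall c Δ} =
        if ‖∑ i, sign A i • v i - c‖ ≤ Δ then 1 else 0 := by
    intro A
    rw [Measure.dirac_apply' _ hm]
    simp [Set.indicator_apply, randomSum, dist_eq_norm]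
  rw [ballProb, signsLaw_eq_sum_dirac, Measure.real]
  simp only [Measure.smul_apply, Measure.finsetSum_apply, h, smul_eq_mul, Finset.sum_boole]
  simp [div_eq_inv_mul]

/-! ### Anticoncentration on the line -/

open Classical in
/-- **Sperner's theorem** on a set `T` of coordinates, the other coordinates being free: if members
of `𝒜` which agree off `T` are incomparable, then each of the possible traces off `T` is taken by
at most as many members as an antichain in `T` can have. -/
lemma card_le_of_antichain_on {ι : Type*} [Fintype ι] (T : Finset ι) (𝒜 : Finset (Finset ι))
    (h : ∀ A ∈ 𝒜, ∀ B ∈ 𝒜, A \ T = B \ T → A ⊆ B → A = B) :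
    𝒜.card ≤ 2 ^ (Fintype.card ι - T.card) * T.card.choose (T.card / 2) := by
  have key : ∀ R ∈ (Tᶜ).powerset, (𝒜.filter fun A => A \ T = R).card ≤
      T.card.choose (T.card / 2) := by
    intro R _
    have hinj : Set.InjOn (fun A : Finset ι => A.subtype (· ∈ T))
        (𝒜.filter fun A => A \ T = R) := by
      intro A hA B hB hAB
      have hA' := (Finset.mem_filter.1 hA).2
      have hB' := (Finset.mem_filter.1 hB).2
      ext x
      by_cases hx : x ∈ T
      · have := Finset.ext_iff.1 hAB ⟨x, hx⟩
        simpa using this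
      · have := Finset.ext_iff.1 (hA'.trans hB'.symm) x
        simpa [hx] using this
    rw [← Finset.card_image_of_injOn hinj]
    have hanti : IsAntichain (· ⊆ ·) (SetLike.coe ((𝒜.filter fun A => A \ T = R).image
        fun A : Finset ι => A.subtype (· ∈ T))) := by
      rintro _ hX _ hY hne hsub
      obtain ⟨A, hA, rfl⟩ := Finset.mem_image.1 hX
      obtain ⟨B, hB, rfl⟩ := Finset.mem_image.1 hY
      obtain ⟨hA1, hA2⟩ := Finset.mem_filter.1 hA
      obtain ⟨hB1, hB2⟩ := Finset.mem_filter.1 hB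
      refine hne ?_
      rw [h A hA1 B hB1 (hA2.trans hB2.symm) fun x hx => ?_]
      by_cases hxT : x ∈ T
      · have := @hsub ⟨x, hxT⟩ (by simpa using hx)
        simpa using this
      · have : x ∈ A \ T := Finset.mem_sdiff.2 ⟨hx, hxT⟩
        rw [hA2, ← hB2] at this
        exact (Finset.mem_sdiff.1 this).1
    have := hanti.sperner
    rwa [Fintype.card_coe] at this
  have hmaps : ∀ A ∈ 𝒜, A \ T ∈ (Tᶜ).powerset := fun A _ => by
    rw [Finset.mem_powerset]
    intro x hx
    exact Finset.mem_compl.2 (Finset.mem_sdiff.1 hx).2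
  have := Finset.card_le_mul_card_image_of_maps_to hmaps _ key
  rwa [Finset.card_powerset, Finset.card_compl, mul_comm] at this

open Classical in
/-- A sum of signs whose coefficients are nonnegative, and at least `r` on `T`, hits a half-open
interval of length `2 * r` at most as often as Sperner's theorem allows, since flipping a sign indexed
by `T` upwards moves the sum by at least the length of the interval. -/
lemma card_sum_mem_Ico_le {ι : Type*} [Fintype ι] (a : ι → ℝ) (ha : ∀ i, 0 ≤ a i) {r : ℝ}
    (T : Finset ι) (hT : ∀ i ∈ T, r ≤ a i) (x : ℝ) :
    (Finset.univ.filter fun A : Finset ι =>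
        x ≤ ∑ i, sign A i * a i ∧ ∑ i, sign A i * a i < x + 2 * r).card ≤
      2 ^ (Fintype.card ι - T.card) * T.card.choose (T.card / 2) := by
  refine card_le_of_antichain_on T _ fun A hA B hB hAB hsub => ?_
  by_contra hne
  obtain ⟨i, hiB, hiA⟩ : ∃ i ∈ B, i ∉ A := by
    by_contra hcon
    push Not at hcon
    exact hne (Finset.Subset.antisymm hsub hcon)
  have hiT : i ∈ T := by
    by_contra hiT
    have : i ∈ B \ T := Finset.mem_sdiff.2 ⟨hiB, hiT⟩
    rw [← hAB] at this
    exact hiA (Finset.mem_sdiff.1 this).1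
  have hge : 2 * a i ≤ ∑ j, (sign B j * a j - sign A j * a j) := by
    have h0 : ∀ j ∈ Finset.univ, 0 ≤ sign B j * a j - sign A j * a j := by
      intro j _
      have := ha j
      by_cases hA' : j ∈ A
      · rw [sign_of_mem hA', sign_of_mem (hsub hA')]; simp
      · by_cases hB' : j ∈ B
        · rw [sign_of_notMem hA', sign_of_mem hB']; linarith
        · rw [sign_of_notMem hA', sign_of_notMem hB']; simp
    refine le_trans ?_ (Finset.single_le_sum h0 (Finset.mem_univ i))
    rw [sign_of_notMem hiA, sign_of_mem hiB]
    linarith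
  rw [Finset.sum_sub_distrib] at hge
  have h1 := (Finset.mem_filter.1 hA).2.1
  have h2 := (Finset.mem_filter.1 hB).2.2
  linarith [hT i hiT]

open Classical in
/-- An interval of length `2 * Δ < 2 * s * r` is covered by `s` half-open intervals of length
`2 * r`. -/
lemma card_abs_sum_sub_le_of_nonneg {ι : Type*} [Fintype ι] (a : ι → ℝ) (ha : ∀ i, 0 ≤ a i) {r Δ : ℝ}
    (hr : 0 < r) (s : ℕ) (hs : Δ < s * r) (T : Finset ι) (hT : ∀ i ∈ T, r ≤ a i) (c : ℝ) :
    (Finset.univ.filter fun A : Finset ι => |∑ i, sign A i * a i - c| ≤ Δ).card ≤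
      s * (2 ^ (Fintype.card ι - T.card) * T.card.choose (T.card / 2)) := by
  have hsub : (Finset.univ.filter fun A : Finset ι => |∑ i, sign A i * a i - c| ≤ Δ) ⊆
      (Finset.range s).biUnion fun j => Finset.univ.filter fun A : Finset ι =>
        (c - Δ + 2 * r * j) ≤ ∑ i, sign A i * a i ∧
          ∑ i, sign A i * a i < (c - Δ + 2 * r * j) + 2 * r := by
    intro A hA
    obtain ⟨h1, h2⟩ := abs_le.1 (Finset.mem_filter.1 hA).2
    have hy : 0 ≤ (∑ i, sign A i * a i - (c - Δ)) / (2 * r) := by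
      apply div_nonneg <;> linarith
    have hj1 := Nat.floor_le hy
    have hj2 := Nat.lt_floor_add_one ((∑ i, sign A i * a i - (c - Δ)) / (2 * r))
    rw [le_div_iff₀ (by linarith)] at hj1
    rw [div_lt_iff₀ (by linarith)] at hj2
    refine Finset.mem_biUnion.2 ⟨⌊(∑ i, sign A i * a i - (c - Δ)) / (2 * r)⌋₊, ?_, ?_⟩
    · rw [Finset.mem_range, Nat.floor_lt hy, div_lt_iff₀ (by linarith)]
      linarith
    · refine Finset.mem_filter.2 ⟨Finset.mem_univ _, ?_, ?_⟩ <;> linarith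
  refine (Finset.card_le_card hsub).trans ?_
  refine (Finset.card_biUnion_le_card_mul _ _ _ fun j _ =>
    card_sum_mem_Ico_le a ha T hT _).trans ?_
  rw [Finset.card_range]

open Classical in
lemma card_abs_sum_sub_le {ι : Type*} [Fintype ι] (a : ι → ℝ) {r Δ : ℝ} (hr : 0 < r) (s : ℕ)
    (hs : Δ < s * r) (T : Finset ι) (hT : ∀ i ∈ T, r ≤ |a i|) (c : ℝ) :
    (Finset.univ.filter fun A : Finset ι => |∑ i, sign A i * a i - c| ≤ Δ).card ≤
      s * (2 ^ (Fintype.card ι - T.card) * T.card.choose (T.card / 2)) := by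
  refine le_trans (le_of_eq ?_)
    (card_abs_sum_sub_le_of_nonneg (fun i => |a i|) (fun i => abs_nonneg _) hr s hs T hT c)
  -- Flip the signs of the negative coefficients.
  set N : Finset ι := Finset.univ.filter fun i => a i < 0 with hN
  have hsum : ∀ A : Finset ι, ∑ i, sign (symmDiff A N) i * |a i| = ∑ i, sign A i * a i := by
    intro A
    refine Finset.sum_congr rfl fun i _ => ?_
    by_cases hi : a i < 0
    · have hiN : i ∈ N := Finset.mem_filter.2 ⟨Finset.mem_univ _, hi⟩
      rw [abs_of_neg hi]
      by_cases hA : i ∈ A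
      · rw [sign_of_mem hA, sign_of_notMem (by simp [Finset.mem_symmDiff, hA, hiN])]; ring
      · rw [sign_of_notMem hA, sign_of_mem (by simp [Finset.mem_symmDiff, hA, hiN])]; ring
    · have hiN : i ∉ N := fun h => hi (Finset.mem_filter.1 h).2
      rw [abs_of_nonneg (not_lt.1 hi)]
      by_cases hA : i ∈ A
      · rw [sign_of_mem hA, sign_of_mem (by simp [Finset.mem_symmDiff, hA, hiN])]
      · rw [sign_of_notMem hA, sign_of_notMem (by simp [Finset.mem_symmDiff, hA, hiN])]
  refine Finset.card_bij (fun A _ => symmDiff A N) ?_ ?_ ?_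
  · intro A hA
    simpa [hsum] using hA
  · intro A _ B _ hAB
    exact symmDiff_left_injective N hAB
  · intro B hB
    refine ⟨symmDiff B N, ?_, symmDiff_symmDiff_cancel_right N B⟩
    rw [Finset.mem_filter, ← hsum, symmDiff_symmDiff_cancel_right]
    simpa using hB

/-- If all but few of the vectors have a large component along a fixed direction, the projection
to this direction already spreads out the random sum. -/
lemma ballProb_le_of_line {d n : ℕ} (v : Fin n → EuclideanSpace ℝ (Fin d))
    (c u : EuclideanSpace ℝ (Fin d)) (hu : ‖u‖ = 1) {r Δ : ℝ} (hr : 0 < r) (s : ℕ)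
    (hs : Δ < s * r) (T : Finset (Fin n)) (hT : ∀ i ∈ T, r ≤ |inner ℝ u (v i)|) :
    ballProb v c Δ ≤ s * centralProb T.card := by
  classical
  have hTn : T.card ≤ n := by simpa using Finset.card_le_univ T
  have h1 := card_abs_sum_sub_le (fun i => inner ℝ u (v i)) hr s hs T hT (inner ℝ u c)
  have h2 : (Finset.univ.filter fun A : Finset (Fin n) => ‖∑ i, sign A i • v i - c‖ ≤ Δ).card ≤
      (Finset.univ.filter fun A : Finset (Fin n) =>
        |∑ i, sign A i * inner ℝ u (v i) - inner ℝ u c| ≤ Δ).card := by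
    refine Finset.card_le_card fun A hA => ?_
    refine Finset.mem_filter.2 ⟨Finset.mem_univ _, le_trans ?_ (Finset.mem_filter.1 hA).2⟩
    have := abs_real_inner_le_norm u (∑ i, sign A i • v i - c)
    rw [hu, one_mul, inner_sub_right, inner_sum] at this
    simpa only [real_inner_smul_right] using this
  have h3 : ((Finset.univ.filter fun A : Finset (Fin n) =>
      ‖∑ i, sign A i • v i - c‖ ≤ Δ).card : ℝ) ≤
        s * (2 ^ (n - T.card) * T.card.choose (T.card / 2)) := by
    rw [Fintype.card_fin] at h1
    exact_mod_cast h2.trans h1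
  rw [ballProb_eq_card_div, div_le_iff₀ (by positivity)]
  refine h3.trans (le_of_eq ?_)
  rw [centralProb, pow_sub₀ _ two_ne_zero hTn]
  field_simp

/-! ### Gaussian sums over progressions -/

lemma exists_sum_exp_neg_sq_le {r : ℝ} (hr : 0 < r) : ∃ K : ℝ, 0 < K ∧ ∀ a : ℝ, r ≤ a → ∀ y : ℝ,
    ∀ N : ℕ, ∑ j ∈ Finset.range N, Real.exp (-(j * a + y) ^ 2 / 2) ≤ K := by
  -- Each cell `[r * k, r * (k + 1))` contains at most one term.
  set h : ℤ → ℝ := fun k => Real.exp (1 / 2 + r) * Real.exp (-(r * |(k : ℝ)|)) with hh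
  have hsum : Summable h := by
    refine Summable.mul_left _ ?_
    have hgeo : Summable fun n : ℕ => Real.exp (-(r * |((n : ℤ) : ℝ)|)) := by
      have hlt : Real.exp (-r) < 1 := Real.exp_lt_one_iff.2 (by linarith)
      refine (summable_geometric_of_lt_one (Real.exp_pos _).le hlt).congr fun n => ?_
      rw [← Real.exp_nat_mul]
      congr 1
      simp
      ring
    refine Summable.of_nat_of_neg hgeo (hgeo.congr fun n => ?_)
    simp
  have hpos : ∀ k, 0 < h k := fun k => by positivity
  refine ⟨∑' k, h k, hsum.tsum_pos (fun k => (hpos k).le) 0 (hpos 0), fun a ha y N => ?_⟩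
  have hterm : ∀ x : ℝ, Real.exp (-x ^ 2 / 2) ≤ h ⌊x / r⌋ := by
    intro x
    rw [hh]
    simp only
    rw [← Real.exp_add]
    refine Real.exp_le_exp.2 ?_
    have h1 := Int.floor_le (x / r)
    have h2 := Int.lt_floor_add_one (x / r)
    rw [le_div_iff₀ hr] at h1
    rw [div_lt_iff₀ hr] at h2
    have h3 : r * |(⌊x / r⌋ : ℝ)| ≤ |x| + r := by
      rcases abs_cases (⌊x / r⌋ : ℝ) with ⟨e, _⟩ | ⟨e, _⟩ <;> rw [e]
      · linarith [le_abs_self x]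
      · linarith [neg_abs_le x]
    nlinarith [sq_nonneg (|x| - 1), sq_abs x]
  have hinj : Function.Injective fun j : ℕ => ⌊(j * a + y) / r⌋ := by
    intro i j hij
    have := Int.abs_sub_lt_one_of_floor_eq_floor hij
    rw [← sub_div, abs_div, abs_of_pos hr, div_lt_one hr] at this
    by_contra hne
    have h1 : (1 : ℝ) ≤ |(i : ℝ) - j| := by
      have : (1 : ℤ) ≤ |(i : ℤ) - j| := Int.one_le_abs (by omega)
      exact_mod_cast this
    have h2 : (i : ℝ) * a + y - (j * a + y) = (i - j) * a := by ring
    rw [h2, abs_mul, abs_of_pos (hr.trans_le ha)] at this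
    nlinarith
  calc ∑ j ∈ Finset.range N, Real.exp (-(j * a + y) ^ 2 / 2)
      ≤ ∑ j ∈ Finset.range N, h ⌊(j * a + y) / r⌋ := Finset.sum_le_sum fun j _ => hterm _
    _ = ∑ k ∈ (Finset.range N).map ⟨_, hinj⟩, h k := by rw [Finset.sum_map]; rfl
    _ ≤ ∑' k, h k := hsum.sum_le_tsum _ fun k _ => (hpos k).le

/-! ### The Gaussian Fourier method -/

open ProbabilityTheory

section Fourier

variable {E : Type*} [NormedAddCommGroup E] [InnerProductSpace ℝ E]

/-- The distance from `w` to the line spanned by the unit vector `u` is at least `ε`, written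
through Pythagoras. -/
def Far (ε : ℝ) (u w : E) : Prop := ε ^ 2 ≤ ‖w‖ ^ 2 - inner ℝ u w ^ 2

lemma norm_smul_add_smul_sq (v w : E) (hv : v ≠ 0) (x y : ℝ) :
    ‖x • v + y • w‖ ^ 2 = (x * ‖v‖ + y * inner ℝ (‖v‖⁻¹ • v) w) ^ 2 +
      y ^ 2 * (‖w‖ ^ 2 - inner ℝ (‖v‖⁻¹ • v) w ^ 2) := by
  have hv' : ‖v‖ ≠ 0 := norm_ne_zero_iff.2 hv
  rw [norm_add_sq_real, norm_smul, norm_smul, mul_pow, mul_pow, real_inner_smul_left,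
    real_inner_smul_right, real_inner_smul_left]
  simp only [Real.norm_eq_abs, sq_abs]
  field_simp
  ring

/-- The Gaussian sum over the lattice generated by two vectors that are quantitatively
independent is bounded uniformly in the two vectors. -/
lemma exists_lattice_sum_le {ε : ℝ} (hε : 0 < ε) (hε1 : ε ≤ 1) : ∃ K : ℝ, 0 < K ∧
    ∀ v w : E, 1 ≤ ‖v‖ → Far ε (‖v‖⁻¹ • v) w → ∀ m N : ℕ,
    ∑ l ∈ Finset.range N, ∑ j ∈ Finset.range N,
      Real.exp (-‖((2 * j - m : ℝ)) • v + ((2 * l - m : ℝ)) • w‖ ^ 2 / 2) ≤ K := by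
  obtain ⟨K, hK, h⟩ := exists_sum_exp_neg_sq_le (mul_pos two_pos hε)
  refine ⟨K * K, mul_pos hK hK, fun v w hv hw m N => ?_⟩
  have hv0 : v ≠ 0 := by
    rintro rfl
    norm_num at hv
  set β := inner ℝ (‖v‖⁻¹ • v) w with hβ
  have hterm : ∀ l j : ℕ, Real.exp (-‖((2 * j - m : ℝ)) • v + ((2 * l - m : ℝ)) • w‖ ^ 2 / 2) ≤
      Real.exp (-(l * (2 * ε) + -(m * ε)) ^ 2 / 2) *
        Real.exp (-(j * (2 * ‖v‖) + ((2 * l - m) * β - m * ‖v‖)) ^ 2 / 2) := by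
    intro l j
    rw [← Real.exp_add, norm_smul_add_smul_sq v w hv0, ← hβ]
    refine Real.exp_le_exp.2 ?_
    have h1 : ε ^ 2 ≤ ‖w‖ ^ 2 - β ^ 2 := hw
    have h2 := mul_le_mul_of_nonneg_left h1 (sq_nonneg (2 * (l : ℝ) - m))
    linarith
  calc _ ≤ ∑ l ∈ Finset.range N, ∑ j ∈ Finset.range N,
        Real.exp (-(l * (2 * ε) + -(m * ε)) ^ 2 / 2) *
        Real.exp (-(j * (2 * ‖v‖) + ((2 * l - m) * β - m * ‖v‖)) ^ 2 / 2) :=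
        Finset.sum_le_sum fun l _ => Finset.sum_le_sum fun j _ => hterm l j
    _ ≤ ∑ l ∈ Finset.range N, Real.exp (-(l * (2 * ε) + -(m * ε)) ^ 2 / 2) * K := by
        refine Finset.sum_le_sum fun l _ => ?_
        rw [← Finset.mul_sum]
        exact mul_le_mul_of_nonneg_left (h _ (by nlinarith) _ _) (Real.exp_pos _).le
    _ ≤ K * K := by
        rw [← Finset.sum_mul]
        exact mul_le_mul_of_nonneg_right (h _ le_rfl _ _) hK.le

/-- Hölder's inequality with equal exponents, in the form used to decouple the factors of a
characteristic function. -/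
lemma integral_prod_le_of_integral_pow_le {α κ : Type*} [MeasurableSpace α] (μ : Measure α)
    [IsProbabilityMeasure μ] (P : Finset κ) (hP : P.card ≠ 0) (h : κ → α → ℝ)
    (h0 : ∀ p x, 0 ≤ h p x) (h1 : ∀ p x, h p x ≤ 1) (hm : ∀ p, Measurable (h p)) {M : ℝ}
    (hM : ∀ p ∈ P, ∫ x, h p x ^ P.card ∂μ ≤ M) : ∫ x, ∏ p ∈ P, h p x ∂μ ≤ M := by
  have hM0 : 0 ≤ M := by
    obtain ⟨p, hp⟩ := Finset.card_ne_zero.1 hP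
    exact (integral_nonneg fun x => pow_nonneg (h0 p x) _).trans (hM p hp)
  have hP' : (0 : ℝ) < P.card := by exact_mod_cast Nat.pos_of_ne_zero hP
  have hi : ∀ p, ∫⁻ x, ENNReal.ofReal (h p x ^ P.card) ∂μ =
      ENNReal.ofReal (∫ x, h p x ^ P.card ∂μ) := by
    intro p
    refine (ofReal_integral_eq_lintegral_ofReal ?_ (ae_of_all _ fun x => pow_nonneg (h0 p x) _)).symm
    refine Integrable.of_bound ((hm p).pow_const _).aestronglyMeasurable 1 (ae_of_all _ fun x => ?_)
    rw [Real.norm_of_nonneg (pow_nonneg (h0 p x) _)]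
    exact pow_le_one₀ (h0 p x) (h1 p x)
  have hmain : ∫⁻ x, ENNReal.ofReal (∏ p ∈ P, h p x) ∂μ ≤ ENNReal.ofReal M := by
    calc ∫⁻ x, ENNReal.ofReal (∏ p ∈ P, h p x) ∂μ
        = ∫⁻ x, ∏ p ∈ P, ENNReal.ofReal (h p x ^ P.card) ^ ((P.card : ℝ)⁻¹) ∂μ := by
          refine lintegral_congr fun x => ?_
          rw [ENNReal.ofReal_prod_of_nonneg fun p _ => h0 p x]
          refine Finset.prod_congr rfl fun p _ => ?_
          rw [ENNReal.ofReal_pow (h0 p x), ENNReal.pow_rpow_inv_natCast hP]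
      _ ≤ ∏ p ∈ P, (∫⁻ x, ENNReal.ofReal (h p x ^ P.card) ∂μ) ^ ((P.card : ℝ)⁻¹) := by
          refine ENNReal.lintegral_prod_norm_pow_le P
            (fun p _ => ((hm p).pow_const _).ennreal_ofReal.aemeasurable) ?_
            fun p _ => (inv_pos.2 hP').le
          rw [Finset.sum_const, nsmul_eq_mul, mul_inv_cancel₀ hP'.ne']
      _ ≤ ∏ _p ∈ P, (ENNReal.ofReal M) ^ ((P.card : ℝ)⁻¹) := by
          refine Finset.prod_le_prod' fun p hp => ?_
          rw [hi]
          exact ENNReal.rpow_le_rpow (ENNReal.ofReal_le_ofReal (hM p hp)) (inv_pos.2 hP').le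
      _ = ENNReal.ofReal M := by
          rw [Finset.prod_const, ENNReal.rpow_inv_natCast_pow hP]
  rw [integral_eq_lintegral_of_nonneg_ae (ae_of_all _ fun x => Finset.prod_nonneg fun p _ => h0 p x)
    (Finset.measurable_prod _ fun p _ => hm p).aestronglyMeasurable]
  exact ENNReal.toReal_le_of_le_ofReal hM0 hmain

variable [FiniteDimensional ℝ E] [MeasurableSpace E] [BorelSpace E]

lemma integrable_exp_inner_mul_I (x : E) :
    Integrable (fun g : E => Complex.exp ((inner ℝ g x : ℝ) * Complex.I)) (stdGaussian E) := by
  refine Integrable.of_bound (by fun_prop) 1 (ae_of_all _ fun g => ?_)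
  rw [Complex.norm_exp_ofReal_mul_I]

lemma integral_exp_inner_mul_I (x : E) :
    ∫ g : E, Complex.exp ((inner ℝ g x : ℝ) * Complex.I) ∂(stdGaussian E) =
      (Real.exp (-‖x‖ ^ 2 / 2) : ℝ) := by
  have := charFun_stdGaussian (E := E) x
  rw [charFun_apply] at this
  rw [this]
  push_cast
  rfl

open Classical in
/-- Fourier inversion against the Gaussian weight: averaging `exp (-‖X - c‖² / 2)` over the random
signs and taking absolute values of the characteristic function inside the integral. -/
lemma sum_exp_neg_norm_sq_le {ι : Type*} [Fintype ι] (v : ι → E) (c : E) :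
    (∑ A : Finset ι, Real.exp (-‖∑ i, sign A i • v i - c‖ ^ 2 / 2)) ≤
      2 ^ Fintype.card ι * ∫ g, ∏ i, |Real.cos (inner ℝ g (v i))| ∂(stdGaussian E) := by
  have hpt : ∀ g : E, ∑ A : Finset ι,
      Complex.exp ((inner ℝ g (∑ i, sign A i • v i - c) : ℝ) * Complex.I) =
        Complex.exp ((-inner ℝ g c : ℝ) * Complex.I) *
          ((2 ^ Fintype.card ι * ∏ i, Real.cos (inner ℝ g (v i)) : ℝ) : ℂ) := by
    intro g
    have h1 : ((2 ^ Fintype.card ι * ∏ i, Real.cos (inner ℝ g (v i)) : ℝ) : ℂ) =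
        ∏ i, (Complex.exp ((inner ℝ g (v i) : ℝ) * Complex.I) +
          Complex.exp (-(inner ℝ g (v i) : ℝ) * Complex.I)) := by
      rw [← Finset.card_univ, ← Finset.prod_const, ← Finset.prod_mul_distrib]
      push_cast
      exact Finset.prod_congr rfl fun i _ => Complex.two_cos _
    rw [h1, Fintype.prod_add, Finset.mul_sum]
    refine Finset.sum_congr rfl fun A _ => ?_
    rw [← Complex.exp_sum, ← Complex.exp_sum, ← Complex.exp_add, ← Complex.exp_add]
    congr 1
    have h2 : inner ℝ g (∑ i, sign A i • v i - c) =
        ∑ i ∈ A, inner ℝ g (v i) + ∑ i ∈ Aᶜ, -inner ℝ g (v i) - inner ℝ g c := by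
      rw [inner_sub_right, inner_sum, ← Finset.sum_add_sum_compl A]
      congr 2
      · exact Finset.sum_congr rfl fun i hi => by
          rw [sign_of_mem hi, one_smul]
      · exact Finset.sum_congr rfl fun i hi => by
          rw [sign_of_notMem (Finset.mem_compl.1 hi), neg_one_smul, inner_neg_right]
    rw [h2, ← Finset.sum_mul, ← Finset.sum_mul]
    push_cast
    ring
  have hint : ((∑ A : Finset ι, Real.exp (-‖∑ i, sign A i • v i - c‖ ^ 2 / 2) : ℝ) : ℂ) =
      ∫ g : E, Complex.exp ((-inner ℝ g c : ℝ) * Complex.I) *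
          ((2 ^ Fintype.card ι * ∏ i, Real.cos (inner ℝ g (v i)) : ℝ) : ℂ) ∂(stdGaussian E) := by
    rw [← integral_congr_ae (ae_of_all _ hpt),
      integral_finsetSum _ fun A _ => integrable_exp_inner_mul_I _, Complex.ofReal_sum]
    exact Finset.sum_congr rfl fun A _ => (integral_exp_inner_mul_I _).symm
  have h0 : 0 ≤ ∑ A : Finset ι, Real.exp (-‖∑ i, sign A i • v i - c‖ ^ 2 / 2) :=
    Finset.sum_nonneg fun A _ => (Real.exp_pos _).le
  rw [← Real.norm_of_nonneg h0, ← Complex.norm_real, hint, ← integral_const_mul]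
  refine (norm_integral_le_integral_norm _).trans (le_of_eq ?_)
  refine integral_congr_ae (ae_of_all _ fun g => ?_)
  simp only
  rw [norm_mul, Complex.norm_exp_ofReal_mul_I, one_mul, Complex.norm_real, norm_mul, norm_prod]
  simp

lemma cos_pow_eq_sum (θ : ℝ) (m : ℕ) : ((Real.cos θ : ℝ) : ℂ) ^ m =
    ∑ j ∈ Finset.range (m + 1), (((m.choose j : ℝ) / 2 ^ m : ℝ) : ℂ) *
      Complex.exp (((2 * j - m : ℝ) * θ : ℝ) * Complex.I) := by
  have h : ((Real.cos θ : ℝ) : ℂ) =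
      (Complex.exp (θ * Complex.I) + Complex.exp (-θ * Complex.I)) / 2 := by
    rw [Complex.ofReal_cos, Complex.cos]
  rw [h, div_pow, add_pow, Finset.sum_div]
  refine Finset.sum_congr rfl fun j hj => ?_
  have hj' : j ≤ m := Nat.lt_succ_iff.1 (Finset.mem_range.1 hj)
  rw [← Complex.exp_nat_mul, ← Complex.exp_nat_mul, ← Complex.exp_add, Nat.cast_sub hj']
  have e : (j : ℂ) * (θ * Complex.I) + ((m : ℂ) - j) * (-θ * Complex.I) =
      (((2 * j - m : ℝ) * θ : ℝ) : ℂ) * Complex.I := by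
    push_cast
    ring
  rw [e]
  push_cast
  ring

/-- The sum of `m` signed copies of `v` and `m` signed copies of `w` has independent binomial
coordinates in the lattice generated by `v` and `w`. -/
lemma integral_cos_mul_cos_pow (v w : E) (m : ℕ) :
    ∫ g, (Real.cos (inner ℝ g v) * Real.cos (inner ℝ g w)) ^ m ∂(stdGaussian E) =
      ∑ l ∈ Finset.range (m + 1), ∑ j ∈ Finset.range (m + 1),
        ((m.choose l : ℝ) / 2 ^ m) * ((m.choose j : ℝ) / 2 ^ m) *
          Real.exp (-‖((2 * j - m : ℝ)) • v + ((2 * l - m : ℝ)) • w‖ ^ 2 / 2) := by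
  have hpt : ∀ g : E, (((Real.cos (inner ℝ g v) * Real.cos (inner ℝ g w)) ^ m : ℝ) : ℂ) =
      ∑ l ∈ Finset.range (m + 1), ∑ j ∈ Finset.range (m + 1),
        ((((m.choose l : ℝ) / 2 ^ m) * ((m.choose j : ℝ) / 2 ^ m) : ℝ) : ℂ) *
          Complex.exp ((inner ℝ g (((2 * j - m : ℝ)) • v + ((2 * l - m : ℝ)) • w) : ℝ) *
            Complex.I) := by
    intro g
    rw [mul_pow, Complex.ofReal_mul, Complex.ofReal_pow, Complex.ofReal_pow, cos_pow_eq_sum,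
      cos_pow_eq_sum, mul_comm, Finset.sum_mul_sum]
    refine Finset.sum_congr rfl fun l _ => Finset.sum_congr rfl fun j _ => ?_
    rw [inner_add_right, real_inner_smul_right, real_inner_smul_right, Complex.ofReal_add, add_mul,
      Complex.exp_add, Complex.ofReal_mul (_ / _)]
    ring
  rw [← Complex.ofReal_inj, ← integral_complex_ofReal, integral_congr_ae (ae_of_all _ hpt),
    integral_finsetSum _ fun l _ => integrable_finsetSum _ fun j _ =>
      (integrable_exp_inner_mul_I _).const_mul _, Complex.ofReal_sum]
  refine Finset.sum_congr rfl fun l _ => ?_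
  rw [integral_finsetSum _ fun j _ => (integrable_exp_inner_mul_I _).const_mul _,
    Complex.ofReal_sum]
  refine Finset.sum_congr rfl fun j _ => ?_
  rw [integral_const_mul, integral_exp_inner_mul_I, ← Complex.ofReal_mul]

lemma integral_cos_mul_cos_pow_le (v w : E) (m : ℕ) {K : ℝ}
    (hK : ∑ l ∈ Finset.range (m + 1), ∑ j ∈ Finset.range (m + 1),
      Real.exp (-‖((2 * j - m : ℝ)) • v + ((2 * l - m : ℝ)) • w‖ ^ 2 / 2) ≤ K) :
    ∫ g, (Real.cos (inner ℝ g v) * Real.cos (inner ℝ g w)) ^ m ∂(stdGaussian E) ≤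
      centralProb m ^ 2 * K := by
  rw [integral_cos_mul_cos_pow]
  refine le_trans ?_ (mul_le_mul_of_nonneg_left hK (sq_nonneg _))
  rw [Finset.mul_sum]
  refine Finset.sum_le_sum fun l _ => ?_
  rw [Finset.mul_sum]
  refine Finset.sum_le_sum fun j _ => ?_
  rw [sq (centralProb m)]
  exact mul_le_mul_of_nonneg_right (mul_le_mul (choose_div_le_centralProb m l)
    (choose_div_le_centralProb m j) (by positivity) (centralProb_pos m).le) (Real.exp_pos _).le

end Fourier

/-! ### Families that are not close to a line -/

open Classical in
/-- If every member has at least `k` partners, disjoint pairs of partners can be chosen greedily.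
The set of indices used is `U`, and products over `U` factor over the pairs. -/
lemma exists_disjoint_pairs {ι : Type*} [Fintype ι] (R : ι → ι → Prop) (hirr : ∀ i, ¬ R i i)
    (k : ℕ) (hcard : k ≤ Fintype.card ι)
    (hk : ∀ i, k ≤ (Finset.univ.filter fun j => R i j).card) (m : ℕ) (hm : 2 * m ≤ k) :
    ∃ (U : Finset ι) (P : Finset (ι × ι)), P ⊆ U ×ˢ U ∧ U.card = 2 * m ∧ P.card = m ∧
      (∀ p ∈ P, R p.1 p.2) ∧ ∀ f : ι → ℝ, ∏ i ∈ U, f i = ∏ p ∈ P, f p.1 * f p.2 := by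
  induction m with
  | zero => exact ⟨∅, ∅, by simp⟩
  | succ m ih =>
    obtain ⟨U, P, hPU, hU, hP, hR, hprod⟩ := ih (by omega)
    obtain ⟨a, ha⟩ : ∃ a, a ∉ U := by
      by_contra hcon
      push Not at hcon
      have : U = Finset.univ := Finset.eq_univ_of_forall hcon
      rw [this, Finset.card_univ] at hU
      omega
    obtain ⟨b, hb, hbU⟩ : ∃ b ∈ Finset.univ.filter fun j => R a j, b ∉ U :=
      Finset.exists_mem_notMem_of_card_lt_card (by have := hk a; omega)
    have hab : R a b := (Finset.mem_filter.1 hb).2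
    have hne : a ≠ b := fun h => hirr a (by rwa [← h] at hab)
    have haI : a ∉ insert b U := by simp [hne, ha]
    have hpP : (a, b) ∉ P := fun h => ha (Finset.mem_product.1 (hPU h)).1
    refine ⟨insert a (insert b U), insert (a, b) P, ?_, ?_, ?_, ?_, ?_⟩
    · intro p hp
      rcases Finset.mem_insert.1 hp with rfl | hp
      · simp
      · have := Finset.mem_product.1 (hPU hp)
        simp [this.1, this.2]
    · rw [Finset.card_insert_of_notMem haI, Finset.card_insert_of_notMem hbU, hU]
      ring
    · rw [Finset.card_insert_of_notMem hpP, hP]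
    · intro p hp
      rcases Finset.mem_insert.1 hp with rfl | hp
      · exact hab
      · exact hR p hp
    · intro f
      rw [Finset.prod_insert haI, Finset.prod_insert hbU, Finset.prod_insert hpP, hprod, mul_assoc]

open Classical in
/-- If every line through one of the vectors leaves many vectors at distance at least `ε`, then
the random sum is spread out in two dimensions. -/
lemma exists_ballProb_le_of_far (d : ℕ) {ε : ℝ} (hε : 0 < ε) (hε1 : ε ≤ 1) (Δ : ℝ) :
    ∃ C : ℝ, 0 < C ∧ ∀ (n q : ℕ) (v : Fin n → EuclideanSpace ℝ (Fin d))
      (c : EuclideanSpace ℝ (Fin d)), 1 ≤ n → 1 ≤ q → (∀ i, 1 ≤ ‖v i‖) →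
      (∀ i, 4 * q ≤ (Finset.univ.filter fun j => Far ε (‖v i‖⁻¹ • v i) (v j)).card) →
      ballProb v c Δ ≤ C * centralProb (2 * q) ^ 2 := by
  obtain ⟨K, hK, hlat⟩ := exists_lattice_sum_le (E := EuclideanSpace ℝ (Fin d)) hε hε1
  refine ⟨Real.exp (Δ ^ 2 / 2) * K, by positivity, fun n q v c hn hq hv hfar => ?_⟩
  have hcard : 4 * q ≤ Fintype.card (Fin n) := (hfar ⟨0, hn⟩).trans (Finset.card_le_univ _)
  have hirr : ∀ i, ¬ Far ε (‖v i‖⁻¹ • v i) (v i) := by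
    intro i h
    have hvi : ‖v i‖ ≠ 0 := by linarith [hv i]
    rw [Far, real_inner_smul_left, real_inner_self_eq_norm_sq, sq ‖v i‖, inv_mul_cancel_left₀ hvi]
      at h
    nlinarith
  obtain ⟨U, P, -, -, hP, hR, hprod⟩ := exists_disjoint_pairs
    (fun i j => Far ε (‖v i‖⁻¹ • v i) (v j)) hirr (4 * q) hcard hfar (2 * q) (by omega)
  set γ := stdGaussian (EuclideanSpace ℝ (Fin d)) with hγ
  have hbd : ∀ S : Finset (Fin n), Integrable (fun g : EuclideanSpace ℝ (Fin d) =>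
      ∏ i ∈ S, |Real.cos (inner ℝ g (v i))|) γ := by
    intro S
    refine Integrable.of_bound (by fun_prop) 1 (ae_of_all _ fun g => ?_)
    rw [Real.norm_of_nonneg (Finset.prod_nonneg fun i _ => abs_nonneg _)]
    exact Finset.prod_le_one (fun i _ => abs_nonneg _) fun i _ => Real.abs_cos_le_one _
  have h1 : ∫ g, ∏ i, |Real.cos (inner ℝ g (v i))| ∂γ ≤ centralProb (2 * q) ^ 2 * K := by
    calc ∫ g, ∏ i, |Real.cos (inner ℝ g (v i))| ∂γ
        ≤ ∫ g, ∏ i ∈ U, |Real.cos (inner ℝ g (v i))| ∂γ := by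
          refine integral_mono (hbd _) (hbd _) fun g => ?_
          exact Finset.prod_le_prod_of_subset_of_le_one (Finset.subset_univ U)
            (fun i _ => abs_nonneg _) fun i _ _ => Real.abs_cos_le_one _
      _ = ∫ g, ∏ p ∈ P, |Real.cos (inner ℝ g (v p.1))| * |Real.cos (inner ℝ g (v p.2))| ∂γ :=
          integral_congr_ae (ae_of_all _ fun g => hprod _)
      _ ≤ centralProb (2 * q) ^ 2 * K := by
          refine integral_prod_le_of_integral_pow_le γ P (by omega)
            (fun p g => |Real.cos (inner ℝ g (v p.1))| * |Real.cos (inner ℝ g (v p.2))|)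
            (fun p g => by positivity)
            (fun p g => mul_le_one₀ (Real.abs_cos_le_one _) (abs_nonneg _) (Real.abs_cos_le_one _))
            (fun p => by fun_prop) fun p hp => ?_
          rw [hP]
          have := integral_cos_mul_cos_pow_le (v p.1) (v p.2) (2 * q)
            (hlat (v p.1) (v p.2) (hv _) (hR p hp) (2 * q) (2 * q + 1))
          refine le_trans (le_of_eq (integral_congr_ae (ae_of_all _ fun g => ?_))) this
          -- The exponent `2 * q` is even, so the absolute values disappear.
          simp only
          rw [← abs_mul, Even.pow_abs (even_two_mul q)]
  have h2 := sum_exp_neg_norm_sq_le v c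
  rw [Fintype.card_fin] at h2
  have h3 : ((Finset.univ.filter fun A : Finset (Fin n) =>
      ‖∑ i, sign A i • v i - c‖ ≤ Δ).card : ℝ) ≤ Real.exp (Δ ^ 2 / 2) *
        ∑ A : Finset (Fin n), Real.exp (-‖∑ i, sign A i • v i - c‖ ^ 2 / 2) := by
    rw [Finset.card_eq_sum_ones, Finset.sum_filter, Nat.cast_sum, Finset.mul_sum]
    refine Finset.sum_le_sum fun A _ => ?_
    rw [← Real.exp_add]
    split_ifs with hA
    · rw [Nat.cast_one]
      refine Real.one_le_exp ?_
      have := pow_le_pow_left₀ (norm_nonneg _) hA 2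
      linarith
    · rw [Nat.cast_zero]
      exact (Real.exp_pos _).le
  rw [ballProb_eq_card_div, div_le_iff₀ (by positivity)]
  calc _ ≤ _ := h3
    _ ≤ Real.exp (Δ ^ 2 / 2) * (2 ^ n * (centralProb (2 * q) ^ 2 * K)) :=
        mul_le_mul_of_nonneg_left
          (h2.trans (mul_le_mul_of_nonneg_left h1 (by positivity))) (Real.exp_pos _).le
    _ = _ := by ring

/-! ### Bounds for the small ball probability -/

lemma smallBallProb_le {d n : ℕ} (hd : 1 ≤ d) {Δ M : ℝ}
    (h : ∀ (v : Fin n → EuclideanSpace ℝ (Fin d)) (c : EuclideanSpace ℝ (Fin d)),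
      (∀ i, 1 ≤ ‖v i‖) → ballProb v c Δ ≤ M) : smallBallProb d n Δ ≤ M := by
  refine csSup_le ⟨_, fun _ => EuclideanSpace.single ⟨0, hd⟩ 1, 0, fun i => ?_, rfl⟩ ?_
  · simp
  · rintro p ⟨v, c, hv, rfl⟩
    exact h v c hv

lemma ballProb_le_one {d n : ℕ} (v : Fin n → EuclideanSpace ℝ (Fin d))
    (c : EuclideanSpace ℝ (Fin d)) (Δ : ℝ) : ballProb v c Δ ≤ 1 := by
  classical
  rw [ballProb_eq_card_div]
  refine div_le_one_of_le₀ ?_ (by positivity)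
  have := Finset.card_le_univ (Finset.univ.filter fun A : Finset (Fin n) =>
    ‖∑ i, sign A i • v i - c‖ ≤ Δ)
  rw [Fintype.card_finset, Fintype.card_fin] at this
  exact_mod_cast this

lemma ballProb_le_smallBallProb {d n : ℕ} (v : Fin n → EuclideanSpace ℝ (Fin d))
    (hv : ∀ i, 1 ≤ ‖v i‖) (c : EuclideanSpace ℝ (Fin d)) (Δ : ℝ) :
    ballProb v c Δ ≤ smallBallProb d n Δ := by
  refine le_csSup ⟨1, ?_⟩ ⟨v, c, hv, rfl⟩
  rintro p ⟨v, c, -, rfl⟩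
  exact ballProb_le_one v c Δ

lemma sum_sign {ι : Type*} [Fintype ι] (A : Finset ι) :
    ∑ i, sign A i = 2 * A.card - Fintype.card ι := by
  classical
  have h : ∀ i, sign A i = 2 * (if i ∈ A then 1 else 0) - 1 := by
    intro i
    by_cases hi : i ∈ A
    · rw [sign_of_mem hi]; norm_num [hi]
    · rw [sign_of_notMem hi]; norm_num [hi]
  rw [Finset.sum_congr rfl fun i _ => h i, Finset.sum_sub_distrib, ← Finset.mul_sum]
  simp

/-- The extremal example: all vectors equal to one unit vector, and a ball centred so that it
holds `s` consecutive values of the sum. -/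
lemma middleMass_le_smallBallProb {d : ℕ} (hd : 1 ≤ d) (n s : ℕ) {Δ : ℝ} (hs : (s : ℝ) ≤ Δ + 1) :
    middleMass n s ≤ smallBallProb d n Δ := by
  classical
  set e : EuclideanSpace ℝ (Fin d) := EuclideanSpace.single ⟨0, hd⟩ 1 with he
  have he1 : ‖e‖ = 1 := by simp [he]
  refine le_trans ?_ (ballProb_le_smallBallProb (fun _ : Fin n => e) (fun _ => he1.ge)
    ((2 * (n / 2 : ℕ) + (s - 1) - n : ℝ) • e) Δ)
  rw [ballProb_eq_card_div, middleMass, ← Finset.sum_div]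
  gcongr
  have hcard : ∑ j ∈ Finset.range s, n.choose (n / 2 + j) =
      ((Finset.range s).biUnion fun j =>
        Finset.powersetCard (n / 2 + j) (Finset.univ : Finset (Fin n))).card := by
    rw [Finset.card_biUnion]
    · refine Finset.sum_congr rfl fun j _ => ?_
      rw [Finset.card_powersetCard, Finset.card_univ, Fintype.card_fin]
    · intro i _ j _ hij
      exact Finset.pairwise_disjoint_powersetCard _ (by omega)
  have hle : ∑ j ∈ Finset.range s, n.choose (n / 2 + j) ≤ _ := hcard.le.trans
    (Finset.card_le_card (t := Finset.univ.filter fun A : Finset (Fin n) =>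
      ‖∑ i, sign A i • e - (2 * (n / 2 : ℕ) + (s - 1) - n : ℝ) • e‖ ≤ Δ) ?_)
  · exact_mod_cast hle
  intro A hA
  obtain ⟨j, hj, hAj⟩ := Finset.mem_biUnion.1 hA
  have hAc : A.card = n / 2 + j := (Finset.mem_powersetCard.1 hAj).2
  refine Finset.mem_filter.2 ⟨Finset.mem_univ _, ?_⟩
  rw [← Finset.sum_smul, ← sub_smul, norm_smul, he1, mul_one, sum_sign, hAc, Fintype.card_fin,
    Real.norm_eq_abs, abs_le]
  have hj' : ((j + 1 : ℕ) : ℝ) ≤ s := by exact_mod_cast Finset.mem_range.1 hj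
  have hj0 : (0 : ℝ) ≤ j := Nat.cast_nonneg j
  push_cast at hj' ⊢
  constructor <;> linarith

/-- The dichotomy: either all but `4 * q` of the vectors are close to a common line, and the
one-dimensional bound applies, or the random sum spreads out in two dimensions. -/
lemma exists_smallBallProb_le_max {d : ℕ} (hd : 1 ≤ d) {Δ : ℝ} (hΔ : 0 ≤ Δ) (s : ℕ) (hs : Δ < s) :
    ∃ C : ℝ, 0 < C ∧ ∀ n q : ℕ, 1 ≤ n → 1 ≤ q → smallBallProb d n Δ ≤
      max (s * centralProb (n - 4 * q)) (C * centralProb (2 * q) ^ 2) := by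
  classical
  have hs0 : (0 : ℝ) < s := hΔ.trans_lt hs
  -- The components along the line shrink by at most the factor `r`, chosen so close to `1` that
  -- an interval of length `2 * Δ` still fits into `s` intervals of length `2 * r`.
  set r : ℝ := (Δ / s + 1) / 2 with hr
  have hx0 : 0 ≤ Δ / s := by positivity
  have hx1 : Δ / s < 1 := (div_lt_one hs0).2 hs
  have hr0 : 0 < r := by linarith
  have hr1 : r < 1 := by linarith
  have hsr : Δ < s * r := by
    have : s * (Δ / s) = Δ := mul_div_cancel₀ _ hs0.ne'
    rw [hr]
    nlinarith
  have hε2 : 0 < 1 - r ^ 2 := by nlinarith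
  have hsq : √(1 - r ^ 2) ^ 2 = 1 - r ^ 2 := Real.sq_sqrt hε2.le
  obtain ⟨C, hC, hfar⟩ := exists_ballProb_le_of_far d (Real.sqrt_pos.2 hε2)
    (Real.sqrt_le_one.2 (by nlinarith)) Δ
  refine ⟨C, hC, fun n q hn hq => smallBallProb_le hd fun v c hv => ?_⟩
  by_cases h : ∀ i, 4 * q ≤
      (Finset.univ.filter fun j => Far √(1 - r ^ 2) (‖v i‖⁻¹ • v i) (v j)).card
  · exact (hfar n q v c hn hq hv h).trans (le_max_right _ _)
  · push Not at h
    obtain ⟨i, hi⟩ := h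
    refine le_trans ?_ (le_max_left _ _)
    have hvi : ‖v i‖ ≠ 0 := by linarith [hv i]
    have hu : ‖‖v i‖⁻¹ • v i‖ = 1 := by
      rw [norm_smul, norm_inv, norm_norm, inv_mul_cancel₀ hvi]
    set F := Finset.univ.filter fun j => Far √(1 - r ^ 2) (‖v i‖⁻¹ • v i) (v j) with hF
    refine (ballProb_le_of_line v c (‖v i‖⁻¹ • v i) hu hr0 s hsr Fᶜ fun j hj => ?_).trans ?_
    · have hj' : ¬ Far √(1 - r ^ 2) (‖v i‖⁻¹ • v i) (v j) := by simpa [hF] using hj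
      rw [Far, hsq, not_le] at hj'
      refine abs_le_of_sq_le_sq' ?_ (abs_nonneg _) |>.2
      rw [sq_abs]
      nlinarith [hv j]
    · gcongr
      refine centralProb_antitone ?_
      rw [Finset.card_compl, Fintype.card_fin]
      omega

/-! ### Asymptotics -/

lemma tendsto_natCast_rpow_neg : Tendsto (fun n : ℕ => (n : ℝ) ^ (-(1 / 4) : ℝ)) atTop (nhds 0) :=
  (tendsto_rpow_neg_atTop (by norm_num)).comp tendsto_natCast_atTop_atTop

/-- Removing `o(n)` steps does not change the order of `centralProb n`. -/
lemma tendsto_centralProb_sub_div {k : ℕ → ℕ}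
    (hk : Tendsto (fun n : ℕ => (k n : ℝ) / (n + 1)) atTop (nhds 0)) :
    Tendsto (fun n => centralProb (n - k n) / centralProb n) atTop (nhds 1) := by
  have hup : Tendsto (fun n : ℕ => (1 - (k n : ℝ) / (n + 1))⁻¹) atTop (nhds 1) := by
    have := (tendsto_const_nhds (x := (1 : ℝ))).sub hk
    rw [sub_zero] at this
    simpa using this.inv₀ one_ne_zero
  refine tendsto_of_tendsto_of_tendsto_of_le_of_le' tendsto_const_nhds hup
    (Eventually.of_forall fun n => ?_) ?_
  · exact (one_le_div (centralProb_pos n)).2 (centralProb_antitone (Nat.sub_le _ _))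
  · filter_upwards [hk.eventually (gt_mem_nhds one_pos)] with n hn
    have h1 : 0 < 1 - (k n : ℝ) / (n + 1) := by linarith
    have hn1 : (0 : ℝ) < n + 1 := by positivity
    rw [div_le_iff₀ (centralProb_pos n), ← div_eq_inv_mul, le_div_iff₀ h1]
    have h2 : ((n - k n : ℕ) + 1) * centralProb (n - k n) ≤ ((n : ℝ) + 1) * centralProb n :=
      monotone_succ_mul_centralProb (Nat.sub_le n (k n))
    have h3 : (n : ℝ) ≤ (n - k n : ℕ) + k n := by
      have : n ≤ (n - k n) + k n := by omega
      exact_mod_cast this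
    have h4 : ((n : ℝ) + 1) * (1 - (k n : ℝ) / (n + 1)) = n + 1 - k n := by field_simp
    refine le_of_mul_le_mul_left ?_ hn1
    calc (n + 1 : ℝ) * (centralProb (n - k n) * (1 - (k n : ℝ) / (n + 1)))
        = (n + 1 - k n) * centralProb (n - k n) := by rw [← h4]; ring
      _ ≤ ((n - k n : ℕ) + 1) * centralProb (n - k n) :=
          mul_le_mul_of_nonneg_right (by linarith) (centralProb_pos _).le
      _ ≤ _ := h2

lemma tendsto_ceil_rpow_div :
    Tendsto (fun n : ℕ => ((4 * ⌈(n : ℝ) ^ (3 / 4 : ℝ)⌉₊ : ℕ) : ℝ) / (n + 1)) atTop (nhds 0) := by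
  have h1 : Tendsto (fun n : ℕ => 4 * (n : ℝ) ^ (-(1 / 4) : ℝ) + 4 / (n : ℝ)) atTop (nhds 0) := by
    simpa using (tendsto_natCast_rpow_neg.const_mul 4).add
      (tendsto_const_div_atTop_nhds_zero_nat (4 : ℝ))
  refine squeeze_zero' (Eventually.of_forall fun n => by positivity) ?_ h1
  filter_upwards [eventually_ge_atTop 1] with n hn
  have hn0 : (0 : ℝ) < n := by exact_mod_cast hn
  have h2 := (Nat.ceil_lt_add_one (Real.rpow_nonneg hn0.le (3 / 4 : ℝ))).le
  have h3 : (n : ℝ) ^ (-(1 / 4) : ℝ) = (n : ℝ) ^ (3 / 4 : ℝ) / n := by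
    rw [← Real.rpow_sub_one hn0.ne']
    norm_num
  rw [h3]
  push_cast
  calc 4 * (⌈(n : ℝ) ^ (3 / 4 : ℝ)⌉₊ : ℝ) / (n + 1)
      ≤ 4 * ((n : ℝ) ^ (3 / 4 : ℝ) + 1) / n := by gcongr; linarith
    _ = _ := by ring

/-- The two-dimensional bound is of smaller order than the one-dimensional one. -/
lemma tendsto_centralProb_ceil_sq_div :
    Tendsto (fun n : ℕ => centralProb (2 * ⌈(n : ℝ) ^ (3 / 4 : ℝ)⌉₊) ^ 2 / centralProb n)
      atTop (nhds 0) := by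
  refine squeeze_zero' (Eventually.of_forall fun n =>
    div_nonneg (sq_nonneg _) (centralProb_pos n).le) ?_ tendsto_natCast_rpow_neg
  filter_upwards [eventually_ge_atTop 1] with n hn
  have hn0 : (0 : ℝ) < n := by exact_mod_cast hn
  set q := ⌈(n : ℝ) ^ (3 / 4 : ℝ)⌉₊ with hq
  have hx : 0 < (n : ℝ) ^ (3 / 4 : ℝ) := Real.rpow_pos_of_pos hn0 _
  have hqx : (n : ℝ) ^ (3 / 4 : ℝ) ≤ q := Nat.le_ceil _
  have h1 : centralProb (2 * q) ^ 2 ≤ 1 / (2 * (n : ℝ) ^ (3 / 4 : ℝ)) := by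
    rw [le_div_iff₀ (by positivity), mul_comm]
    refine le_trans ?_ (centralProb_two_mul_sq_le q)
    exact mul_le_mul_of_nonneg_right (by linarith) (sq_nonneg _)
  have h2 : 1 / (2 * (n : ℝ) ^ (1 / 2 : ℝ)) ≤ centralProb n := by
    refine le_of_sq_le_sq ?_ (centralProb_pos n).le
    refine le_trans (le_of_eq ?_) (one_div_le_centralProb_sq n hn)
    have : ((n : ℝ) ^ (1 / 2 : ℝ)) ^ 2 = n := by
      rw [← Real.sqrt_eq_rpow, Real.sq_sqrt hn0.le]
    rw [div_pow, mul_pow, this]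
    norm_num
  rw [div_le_iff₀ (centralProb_pos n)]
  calc centralProb (2 * q) ^ 2 ≤ 1 / (2 * (n : ℝ) ^ (3 / 4 : ℝ)) := h1
    _ = (n : ℝ) ^ (-(1 / 4) : ℝ) * (1 / (2 * (n : ℝ) ^ (1 / 2 : ℝ))) := by
        have h3 : (n : ℝ) ^ (3 / 4 : ℝ) * (n : ℝ) ^ (-(1 / 4) : ℝ) = (n : ℝ) ^ (1 / 2 : ℝ) := by
          rw [← Real.rpow_add hn0]
          norm_num
        have h4 : 0 < (n : ℝ) ^ (-(1 / 4) : ℝ) := Real.rpow_pos_of_pos hn0 _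
        rw [← h3]
        field_simp
    _ ≤ _ := mul_le_mul_of_nonneg_left h2 (Real.rpow_nonneg hn0.le _)

lemma tendsto_smallBallProb_div {d : ℕ} (hd : 1 ≤ d) {Δ : ℝ} (hΔ : 0 ≤ Δ) :
    Tendsto (fun n => smallBallProb d n Δ / centralProb n) atTop
      (nhds ((⌊Δ⌋₊ + 1 : ℕ) : ℝ)) := by
  set s := ⌊Δ⌋₊ + 1 with hs
  have hs1 : Δ < s := by rw [hs]; push_cast; exact Nat.lt_floor_add_one Δ
  have hs2 : (s : ℝ) ≤ Δ + 1 := by rw [hs]; push_cast; linarith [Nat.floor_le hΔ]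
  obtain ⟨C, -, hC⟩ := exists_smallBallProb_le_max hd hΔ s hs1
  have hup := ((tendsto_centralProb_sub_div tendsto_ceil_rpow_div).const_mul (s : ℝ)).max
    (tendsto_centralProb_ceil_sq_div.const_mul C)
  rw [mul_one, mul_zero, max_eq_left (Nat.cast_nonneg s)] at hup
  refine tendsto_of_tendsto_of_tendsto_of_le_of_le' (tendsto_middleMass_div s) hup
    (Eventually.of_forall fun n => ?_) ?_
  · exact div_le_div_of_nonneg_right (middleMass_le_smallBallProb hd n s hs2)
      (centralProb_pos n).le
  · filter_upwards [eventually_ge_atTop 1] with n hn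
    have hn0 : (0 : ℝ) < n := by exact_mod_cast hn
    have hq : 1 ≤ ⌈(n : ℝ) ^ (3 / 4 : ℝ)⌉₊ := Nat.ceil_pos.2 (Real.rpow_pos_of_pos hn0 _)
    rw [mul_div_assoc', mul_div_assoc', max_div_div_right (centralProb_pos n).le]
    exact div_le_div_of_nonneg_right (hC n _ hn hq) (centralProb_pos n).le

lemma tendsto_largestBinomSum_div (s : ℕ) :
    Tendsto (fun n => (((2 : ℝ) ^ n)⁻¹ * largestBinomSum n s) / centralProb n) atTop
      (nhds (s : ℝ)) := by
  refine tendsto_of_tendsto_of_tendsto_of_le_of_le' (tendsto_middleMass_div s) tendsto_const_nhds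
    ?_ (Eventually.of_forall fun n => ?_)
  · filter_upwards [eventually_ge_atTop (2 * s)] with n hn
    exact div_le_div_of_nonneg_right (middleMass_le_largestBinomSum n s (by omega))
      (centralProb_pos n).le
  · exact (div_le_iff₀ (centralProb_pos n)).2 (largestBinomSum_le n s)

end LittlewoodOfford

theorem theorem1p2 (d : ℕ) (hd : 1 ≤ d) (Δ : ℝ) (hΔ : 0 ≤ Δ) :
    (fun n : ℕ => LittlewoodOfford.smallBallProb d n Δ) ~[atTop]
      (fun n : ℕ => ((2 : ℝ) ^ n)⁻¹ *
        (LittlewoodOfford.largestBinomSum n (⌊Δ⌋₊ + 1) : ℝ)) := by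
  have hs : ((⌊Δ⌋₊ + 1 : ℕ) : ℝ) ≠ 0 := by positivity
  have h1 := LittlewoodOfford.tendsto_smallBallProb_div hd hΔ
  have h2 := LittlewoodOfford.tendsto_largestBinomSum_div (⌊Δ⌋₊ + 1)
  have h3 : ∀ᶠ n : ℕ in atTop, ((2 : ℝ) ^ n)⁻¹ *
      (LittlewoodOfford.largestBinomSum n (⌊Δ⌋₊ + 1) : ℝ) ≠ 0 := by
    filter_upwards [h2.eventually_ne hs] with n hn h0
    exact hn (by rw [h0, zero_div])
  rw [isEquivalent_iff_tendsto_one h3]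
  have h4 := h1.div h2 hs
  rw [div_self hs] at h4
  refine h4.congr fun n => ?_
  exact div_div_div_cancel_right₀ (LittlewoodOfford.centralProb_pos n).ne' _ _
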